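/- Let $d\ge 1$ be an integer and write $B_\rho=\{x\in\mathbb{R}^d:\ |x|<\rho\}$. There is a constant $C>0$ depending only on $d$ such that the following holds. Let $R>0$, and let $v\in H^1(B_R,\mathbb{R}^d)$ and $p\in L^2(B_R)$ be a weak solution of the homogeneous Stokes system $$ -\Delta v+\nabla p=0,\qquad \nabla\cdot v=0\qquad\text{in } B_R, $$ that is, $\int_{B_R}\nabla v_i\cdot\nabla\varphi\,dx-\int_{B_R}p\,\partial_i\varphi\,dx=0$ for all $i\in\{1,\dots,d\}$ and all $\varphi\in C_c^\infty(B_R)$, and $\sum_{i}\partial_i v_i=0$ almost everywhere in $B_R$, where derivatives of $v$ are weak derivatives. Then $$ \int_{B_r}|\nabla v|^2\,dx\le C\left(\frac rR\right)^d\int_{B_R}|\nabla v|^2\,dx\qquad\text{for all } 0<r\le R, $$ where $|\nabla v|^2=\sum_{i,j=1}^d(\partial_j v_i)^2$. -/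

import Mathlib

open MeasureTheory Set
open scoped ContDiff

noncomputable section

namespace StokesDecay

/-- Euclidean space `ℝ^d`. -/
abbrev E (d : ℕ) : Type := EuclideanSpace ℝ (Fin d)

/-- `φ ∈ C_c^∞(U)`: real-valued smooth functions with compact support contained in `U`. -/
structure IsTestFunction {d : ℕ} (U : Set (E d)) (φ : E d → ℝ) : Prop where
  smooth : ContDiff ℝ ∞ φ
  compact : HasCompactSupport φ
  support_subset : tsupport φ ⊆ U

/-- The classical partial derivative `∂_i φ (x)`; only used for smooth `φ`. -/
def partialDeriv {d : ℕ} (i : Fin d) (φ : E d → ℝ) (x : E d) : ℝ :=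
  fderiv ℝ φ x (EuclideanSpace.single i 1)

/-- `g ∈ L^1_loc(U)` is a weak `i`-th partial derivative of `f ∈ L^1_loc(U)` in the open set `U`. -/
structure HasWeakPartialDeriv {d : ℕ} (U : Set (E d)) (i : Fin d) (f g : E d → ℝ) : Prop where
  locallyIntegrable : LocallyIntegrableOn f U volume
  locallyIntegrable_deriv : LocallyIntegrableOn g U volume
  integral_eq : ∀ φ : E d → ℝ, IsTestFunction U φ →
    ∫ x in U, f x * partialDeriv i φ x = - ∫ x in U, g x * φ x

/-- The scalar Sobolev space `H^1(U)`. -/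
def MemH1 {d : ℕ} (U : Set (E d)) (f : E d → ℝ) : Prop :=
  MemLp f 2 (volume.restrict U) ∧
    ∀ i, ∃ g, MemLp g 2 (volume.restrict U) ∧ HasWeakPartialDeriv U i f g

/-- The vector-valued Sobolev space `H^1(U, ℝ^d)`: all components lie in `H^1(U)`. -/
def MemH1Vec {d : ℕ} (U : Set (E d)) (v : E d → E d) : Prop :=
  ∀ i, MemH1 U (fun x => v x i)

open Classical in
/-- The weak partial derivative `∂_i f` in `U`. It is unique up to null sets when it exists
(`HasWeakPartialDeriv.ae_eq` below), and set to `0` when it does not exist. -/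
def weakPartial {d : ℕ} (U : Set (E d)) (i : Fin d) (f : E d → ℝ) : E d → ℝ :=
  if h : ∃ g, HasWeakPartialDeriv U i f g then h.choose else 0

/-- `|∇v|^2 = ∑_{i,j} (∂_j v_i)^2`, with weak derivatives in `U`. -/
def gradSq {d : ℕ} (U : Set (E d)) (v : E d → E d) (x : E d) : ℝ :=
  ∑ i, ∑ j, (weakPartial U j (fun y => v y i) x) ^ 2

/-- `v ∈ H^1(U, ℝ^d)` and `p ∈ L^2(U)` solve `-Δ v + ∇ p = 0`, `∇ · v = 0` weakly in `U`.
Each component of the first equation is tested with scalar functions `φ ∈ C_c^∞(U)`. -/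
structure IsStokesSolution {d : ℕ} (U : Set (E d)) (v : E d → E d) (p : E d → ℝ) : Prop where
  memH1 : MemH1Vec U v
  memL2 : MemLp p 2 (volume.restrict U)
  momentum : ∀ i, ∀ φ : E d → ℝ, IsTestFunction U φ →
    (∫ x in U, ∑ j, weakPartial U j (fun y => v y i) x * partialDeriv j φ x)
      - ∫ x in U, p x * partialDeriv i φ x = 0
  divergence : ∀ᵐ x ∂(volume.restrict U), ∑ i, weakPartial U i (fun y => v y i) x = 0

/-- Weak derivatives are unique up to null sets. -/
theorem HasWeakPartialDeriv.ae_eq {d : ℕ} {U : Set (E d)} (hU : IsOpen U) {i : Fin d}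
    {f g h : E d → ℝ} (hg : HasWeakPartialDeriv U i f g) (hh : HasWeakPartialDeriv U i f h) :
    g =ᵐ[volume.restrict U] h := by
  have int : ∀ {k : E d → ℝ}, LocallyIntegrableOn k U volume → ∀ φ : E d → ℝ,
      IsTestFunction U φ → Integrable (fun x => φ x • k x) volume := by
    intro k hk φ hφ
    have h1 : IntegrableOn k (tsupport φ) volume :=
      hk.integrableOn_compact_subset hφ.support_subset hφ.compact
    have h2 : IntegrableOn (fun x => φ x • k x) (tsupport φ) volume :=
      h1.continuousOn_smul hφ.smooth.continuous.continuousOn hφ.compact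
    refine (integrableOn_iff_integrable_of_support_subset ?_).1 h2
    exact (Function.support_smul_subset_left φ k).trans (subset_tsupport φ)
  have key : ∀ᵐ x ∂(volume : Measure (E d)), x ∈ U → (g - h) x = 0 := by
    refine hU.ae_eq_zero_of_integral_contDiff_smul_eq_zero
      (hg.locallyIntegrable_deriv.sub hh.locallyIntegrable_deriv) ?_
    intro φ h1 h2 h3
    have hφ : IsTestFunction U φ := ⟨h1, h2, h3⟩
    have e := (hg.integral_eq φ hφ).symm.trans (hh.integral_eq φ hφ)
    have restr : ∀ k : E d → ℝ, ∫ x in U, k x * φ x = ∫ x, φ x • k x := by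
      intro k
      rw [setIntegral_eq_integral_of_forall_compl_eq_zero]
      · simp only [smul_eq_mul, mul_comm]
      · intro x hx
        rw [image_eq_zero_of_notMem_tsupport (fun hx' => hx (h3 hx')), mul_zero]
    rw [restr, restr, neg_inj] at e
    simp only [Pi.sub_apply, smul_sub]
    rw [integral_sub (int hg.locallyIntegrable_deriv φ hφ) (int hh.locallyIntegrable_deriv φ hφ),
      e, sub_self]
  refine (ae_restrict_iff' hU.measurableSet).2 ?_
  filter_upwards [key] with x hx hxU
  exact sub_eq_zero.1 (hx hxU)

/-- For `f ∈ H^1(U)` the chosen representative is a weak derivative and lies in `L^2(U)`. -/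
theorem MemH1.weakPartial_spec {d : ℕ} {U : Set (E d)} (hU : IsOpen U) {f : E d → ℝ}
    (hf : MemH1 U f) (i : Fin d) :
    HasWeakPartialDeriv U i f (weakPartial U i f) ∧
      MemLp (weakPartial U i f) 2 (volume.restrict U) := by
  obtain ⟨g, hg, hw⟩ := hf.2 i
  have hex : ∃ g, HasWeakPartialDeriv U i f g := ⟨g, hw⟩
  have hc : HasWeakPartialDeriv U i f (weakPartial U i f) := by
    rw [weakPartial, dif_pos hex]
    exact hex.choose_spec
  exact ⟨hc, (memLp_congr_ae (hw.ae_eq hU hc)).1 hg⟩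

end StokesDecay

end

/-! Taking the divergence of the momentum equation shows that `p` is weakly harmonic, and taking its
Laplacian then shows that every entry `w` of the weak gradient of `v` is weakly biharmonic
(`integral_weakPartial_mul_lap_lap`). No regularity theory is needed beyond this: an exact mean
value formula turns weak biharmonicity into a sup bound.

For a smooth profile `f` vanishing on `[1, ∞)`, test `w` with the double Laplacian of `f (‖y - x‖ ^
2 / ε ^ 2)`. Up to a factor depending only on `ε` and `d`, the resulting integral is the
`ε`-derivative of the average of `w` against a rescaled radial kernel (`hasDerivAt_kernelMean`).
These averages are therefore independent of `ε`, and at almost every `x` they tend to `c * w x` as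
`ε → 0`, where `c` is the mass of the kernel (`ae_tendsto_kernelMean`); `f` is chosen so that `c >
0`.

Evaluating at a scale comparable to `R` and applying Cauchy–Schwarz bounds `w ^ 2` on the half ball
by a multiple of its mean over the whole ball (`exists_sq_le_of_biharmonic`). Summing over the
entries and integrating over the ball of radius `r` gives the decay for `r ≤ R / 2`; larger `r` only
cost a factor `2 ^ d`. -/

namespace StokesDecay

open Filter Topology Metric

/-! ### Smooth profiles vanishing on `[1, ∞)` -/

/-- Smooth functions on the line that vanish on `[1, ∞)`. -/
structure IsProfile (f : ℝ → ℝ) : Prop where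
  smooth : ContDiff ℝ ∞ f
  eq_zero : ∀ t, 1 ≤ t → f t = 0

namespace IsProfile

variable {f g : ℝ → ℝ}

theorem differentiable (hf : IsProfile f) : Differentiable ℝ f :=
  hf.smooth.differentiable (by simp)

theorem deriv (hf : IsProfile f) : IsProfile (deriv f) where
  smooth := (contDiff_infty_iff_deriv.1 hf.smooth).2
  eq_zero t ht := by
    -- At `t = 1` only the values to the right are known to vanish, so the derivative is computed
    -- one-sidedly.
    have h : derivWithin f (Ici 1) t = derivWithin (fun _ => (0 : ℝ)) (Ici 1) t :=
      derivWithin_congr (fun y hy => hf.eq_zero y hy) (hf.eq_zero t ht)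
    rw [← (hf.differentiable t).derivWithin (uniqueDiffOn_Ici (1 : ℝ) t ht), h]
    simp

theorem add (hf : IsProfile f) (hg : IsProfile g) : IsProfile (fun t => f t + g t) where
  smooth := hf.smooth.add hg.smooth
  eq_zero t ht := by simp [hf.eq_zero t ht, hg.eq_zero t ht]

theorem mul_left {a : ℝ → ℝ} (ha : ContDiff ℝ ∞ a) (hf : IsProfile f) :
    IsProfile (fun t => a t * f t) where
  smooth := ha.mul hf.smooth
  eq_zero t ht := by simp [hf.eq_zero t ht]

/-- Nothing controls a profile as `t → -∞`; nonnegative arguments suffice because profiles are only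
evaluated at squared norms. -/
theorem exists_bound (hf : IsProfile f) : ∃ M, 0 < M ∧ ∀ t, 0 ≤ t → |f t| ≤ M := by
  obtain ⟨M, hM⟩ := (isCompact_Icc (a := (0 : ℝ)) (b := 1)).exists_bound_of_continuousOn
    hf.smooth.continuous.continuousOn
  refine ⟨max M 1, by positivity, fun t ht => ?_⟩
  rcases le_total t 1 with h | h
  · exact (hM t ⟨ht, h⟩).trans (le_max_left _ _)
  · rw [hf.eq_zero t h, abs_zero]
    positivity

/-- Integrating from the base point `1` keeps the primitive zero on `[1, ∞)`. Applied twice, this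
allows the second derivative of a profile to be prescribed. -/
theorem exists_antideriv (hf : IsProfile f) : ∃ F, IsProfile F ∧ _root_.deriv F = f := by
  have hd : ∀ t, HasDerivAt (fun t => ∫ s in (1 : ℝ)..t, f s) (f t) t := fun t =>
    intervalIntegral.integral_hasDerivAt_right (hf.smooth.continuous.intervalIntegrable _ _)
      (hf.smooth.continuous.stronglyMeasurableAtFilter _ _) hf.smooth.continuous.continuousAt
  have he : _root_.deriv (fun t => ∫ s in (1 : ℝ)..t, f s) = f := funext fun t => (hd t).deriv
  refine ⟨_, ⟨contDiff_infty_iff_deriv.2 ⟨fun t => (hd t).differentiableAt, ?_⟩, ?_⟩, he⟩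
  · rw [he]
    exact hf.smooth
  · intro t ht
    rw [intervalIntegral.integral_congr (g := fun _ => (0 : ℝ))]
    · simp
    · intro s hs
      rw [uIcc_of_le ht] at hs
      exact hf.eq_zero s hs.1

end IsProfile

/-- The Laplacian of `y ↦ f (‖y‖ ^ 2)` on `ℝ^d` is `y ↦ radialLap d f (‖y‖ ^ 2)`. -/
noncomputable def radialLap (d : ℕ) (f : ℝ → ℝ) (t : ℝ) : ℝ :=
  4 * t * deriv (deriv f) t + 2 * d * deriv f t

theorem IsProfile.radialLap {f : ℝ → ℝ} (hf : IsProfile f) (d : ℕ) :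
    IsProfile (radialLap d f) :=
  (hf.deriv.deriv.mul_left (contDiff_const.mul contDiff_id)).add
    (hf.deriv.mul_left contDiff_const)

theorem deriv_comp_div (f : ℝ → ℝ) (a : ℝ) :
    deriv (fun t => f (t / a)) = fun t => deriv f (t / a) / a := by
  funext t
  have := deriv_comp_mul_left a⁻¹ f t
  simp only [smul_eq_mul] at this
  simp only [div_eq_inv_mul]
  exact this

theorem radialLap_comp_div (d : ℕ) (f : ℝ → ℝ) {a : ℝ} (ha : a ≠ 0) :
    radialLap d (fun t => f (t / a)) = fun t => radialLap d f (t / a) / a := by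
  funext t
  simp only [radialLap, deriv_comp_div, deriv_div_const]
  field_simp

/-! ### Partial derivatives -/

/-- The classical Laplacian; only used for smooth `φ`. -/
noncomputable def lap {d : ℕ} (φ : E d → ℝ) (x : E d) : ℝ :=
  ∑ i, partialDeriv i (partialDeriv i φ) x

section Partial

variable {d : ℕ}

theorem contDiff_partialDeriv {φ : E d → ℝ} (hφ : ContDiff ℝ ∞ φ) (i : Fin d) :
    ContDiff ℝ ∞ (partialDeriv i φ) :=
  (hφ.fderiv_right (m := ∞) (by simp)).clm_apply contDiff_const

theorem partialDeriv_comm {φ : E d → ℝ} (hφ : ContDiff ℝ ∞ φ) (i j : Fin d) :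
    partialDeriv i (partialDeriv j φ) = partialDeriv j (partialDeriv i φ) := by
  have key : ∀ (a b : Fin d) (x : E d), partialDeriv a (partialDeriv b φ) x =
      fderiv ℝ (fderiv ℝ φ) x (EuclideanSpace.single a 1) (EuclideanSpace.single b 1) := by
    intro a b x
    have hd : DifferentiableAt ℝ (fderiv ℝ φ) x :=
      ((hφ.fderiv_right (m := ∞) (by simp)).differentiable (by simp)) x
    have : HasFDerivAt (partialDeriv b φ) _ x :=
      hd.hasFDerivAt.clm_apply (hasFDerivAt_const (EuclideanSpace.single b (1 : ℝ)) x)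
    rw [partialDeriv, this.fderiv]
    simp
  funext x
  rw [key, key]
  exact (hφ.contDiffAt.isSymmSndFDerivAt
    (by simpa using ENat.LEInfty.out)).eq _ _

theorem partialDeriv_sum {ι : Type*} (s : Finset ι) {φ : ι → E d → ℝ}
    (hφ : ∀ k, ContDiff ℝ ∞ (φ k)) (i : Fin d) :
    partialDeriv i (fun x => ∑ k ∈ s, φ k x) = fun x => ∑ k ∈ s, partialDeriv i (φ k) x := by
  funext x
  simp only [partialDeriv]
  rw [fderiv_fun_sum fun k _ => ((hφ k).differentiable (by simp)) x]
  simp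

theorem partialDeriv_lap {φ : E d → ℝ} (hφ : ContDiff ℝ ∞ φ) (i : Fin d) :
    partialDeriv i (lap φ) = lap (partialDeriv i φ) := by
  have h2 : ∀ k, ContDiff ℝ ∞ (partialDeriv k (partialDeriv k φ)) := fun k =>
    contDiff_partialDeriv (contDiff_partialDeriv hφ k) k
  unfold lap
  rw [partialDeriv_sum _ h2]
  funext x
  refine Finset.sum_congr rfl fun k _ => ?_
  rw [partialDeriv_comm (contDiff_partialDeriv hφ k), partialDeriv_comm hφ]

theorem IsTestFunction.partialDeriv {U : Set (E d)} {φ : E d → ℝ} (hφ : IsTestFunction U φ)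
    (i : Fin d) : IsTestFunction U (partialDeriv i φ) where
  smooth := contDiff_partialDeriv hφ.smooth i
  compact := hφ.compact.fderiv_apply ℝ _
  support_subset := (tsupport_fderiv_apply_subset ℝ _).trans hφ.support_subset

theorem IsTestFunction.sum {U : Set (E d)} {ι : Type*} (s : Finset ι) {φ : ι → E d → ℝ}
    (hφ : ∀ k, IsTestFunction U (φ k)) : IsTestFunction U (fun x => ∑ k ∈ s, φ k x) := by
  classical
  induction s using Finset.induction_on with
  | empty =>
    simp only [Finset.sum_empty]
    exact ⟨contDiff_const, HasCompactSupport.zero, by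
      rw [show (fun _ : E d => (0 : ℝ)) = 0 from rfl, tsupport_zero]; exact empty_subset _⟩
  | insert a s ha ih =>
    simp only [Finset.sum_insert ha]
    exact ⟨(hφ a).smooth.add ih.smooth, (hφ a).compact.add ih.compact,
      (tsupport_add _ _).trans (union_subset (hφ a).support_subset ih.support_subset)⟩

theorem IsTestFunction.lap {U : Set (E d)} {φ : E d → ℝ} (hφ : IsTestFunction U φ) :
    IsTestFunction U (lap φ) :=
  IsTestFunction.sum _ fun k => (hφ.partialDeriv k).partialDeriv k

/-! ### Radial functions -/

theorem hasFDerivAt_norm_sub_sq (x y : E d) :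
    HasFDerivAt (fun y : E d => ‖y - x‖ ^ 2) (2 • innerSL ℝ (y - x)) y := by
  have := ((hasFDerivAt_id y).sub_const x).norm_sq
  simpa using this

theorem partialDeriv_radial {f : ℝ → ℝ} (hf : Differentiable ℝ f) (x : E d) (i : Fin d) :
    partialDeriv i (fun y => f (‖y - x‖ ^ 2)) =
      fun y => 2 * (y i - x i) * deriv f (‖y - x‖ ^ 2) := by
  funext y
  have h := (hf (‖y - x‖ ^ 2)).hasDerivAt.comp_hasFDerivAt y (hasFDerivAt_norm_sub_sq x y)
  have h' : HasFDerivAt (fun y => f (‖y - x‖ ^ 2)) _ y := h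
  rw [partialDeriv, h'.fderiv]
  simp [EuclideanSpace.inner_single_right]
  ring

theorem sum_sub_sq (x y : E d) : ∑ i, (y i - x i) ^ 2 = ‖y - x‖ ^ 2 := by
  rw [EuclideanSpace.norm_sq_eq]
  simp

theorem lap_radial {f : ℝ → ℝ} (hf : ContDiff ℝ ∞ f) (x : E d) :
    lap (fun y => f (‖y - x‖ ^ 2)) = fun y => radialLap d f (‖y - x‖ ^ 2) := by
  have hf' : Differentiable ℝ f := hf.differentiable (by simp)
  have hf'' : Differentiable ℝ (deriv f) :=
    (contDiff_infty_iff_deriv.1 hf).2.differentiable (by simp)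
  have key : ∀ (i : Fin d) (y : E d),
      partialDeriv i (partialDeriv i (fun y => f (‖y - x‖ ^ 2))) y =
        4 * deriv (deriv f) (‖y - x‖ ^ 2) * (y i - x i) ^ 2 + 2 * deriv f (‖y - x‖ ^ 2) := by
    intro i y
    rw [partialDeriv_radial hf']
    have h1 : HasFDerivAt (fun y : E d => y i) (EuclideanSpace.proj i : E d →L[ℝ] ℝ) y :=
      (EuclideanSpace.proj i : E d →L[ℝ] ℝ).hasFDerivAt
    have h2 := (hf'' (‖y - x‖ ^ 2)).hasDerivAt.comp_hasFDerivAt y (hasFDerivAt_norm_sub_sq x y)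
    have h3 : HasFDerivAt (fun y : E d => 2 * (y i - x i) * deriv f (‖y - x‖ ^ 2)) _ y :=
      ((h1.sub_const (x i)).const_mul 2).fun_mul h2
    rw [partialDeriv, h3.fderiv]
    simp [EuclideanSpace.inner_single_right]
    ring
  funext y
  simp only [lap, key]
  rw [Finset.sum_add_distrib, ← Finset.mul_sum, sum_sub_sq]
  simp [radialLap]
  ring

theorem IsProfile.apply_eq_zero {f : ℝ → ℝ} (hf : IsProfile f) {x y : E d} {ε : ℝ} (hε : 0 < ε)
    (hy : y ∉ ball x ε) : f (‖y - x‖ ^ 2 / ε ^ 2) = 0 := by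
  apply hf.eq_zero
  rw [mem_ball, not_lt, dist_eq_norm] at hy
  rw [one_le_div (by positivity)]
  gcongr

theorem IsProfile.contDiff_radial {f : ℝ → ℝ} (hf : IsProfile f) (x : E d) (ε : ℝ) :
    ContDiff ℝ ∞ (fun y => f (‖y - x‖ ^ 2 / ε ^ 2)) :=
  hf.smooth.comp (((contDiff_id.sub contDiff_const).norm_sq ℝ).div_const _)

theorem IsProfile.tsupport_radial_subset {f : ℝ → ℝ} (hf : IsProfile f) (x : E d) {ε : ℝ}
    (hε : 0 < ε) : tsupport (fun y => f (‖y - x‖ ^ 2 / ε ^ 2)) ⊆ closedBall x ε := by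
  refine closure_minimal (fun y hy => ?_) isClosed_closedBall
  by_contra h
  exact hy (hf.apply_eq_zero hε fun h' => h (ball_subset_closedBall h'))

theorem IsProfile.isTestFunction {f : ℝ → ℝ} (hf : IsProfile f) {x : E d} {ε : ℝ} (hε : 0 < ε)
    {U : Set (E d)} (hU : closedBall x ε ⊆ U) :
    IsTestFunction U (fun y => f (‖y - x‖ ^ 2 / ε ^ 2)) where
  smooth := hf.contDiff_radial x ε
  compact := HasCompactSupport.of_support_subset_isCompact (isCompact_closedBall x ε)
    ((subset_tsupport _).trans (hf.tsupport_radial_subset x hε))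
  support_subset := (hf.tsupport_radial_subset x hε).trans hU

theorem lap_radial_scaled {f : ℝ → ℝ} (hf : IsProfile f) (x : E d) {ε : ℝ} (hε : 0 < ε) :
    lap (fun y => f (‖y - x‖ ^ 2 / ε ^ 2)) =
      fun y => radialLap d f (‖y - x‖ ^ 2 / ε ^ 2) / ε ^ 2 := by
  have := lap_radial (f := fun t => f (t / ε ^ 2)) (hf.smooth.comp (contDiff_id.div_const _)) x
  rw [this, radialLap_comp_div d f (by positivity)]

theorem lap_div_const {φ : E d → ℝ} (hφ : ContDiff ℝ ∞ φ) (c : ℝ) :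
    lap (fun y => φ y / c) = fun y => lap φ y / c := by
  have h : ∀ {ψ : E d → ℝ}, ContDiff ℝ ∞ ψ → ∀ i, partialDeriv i (fun y => ψ y / c) =
      fun y => partialDeriv i ψ y / c := by
    intro ψ hψ i
    funext y
    simp only [partialDeriv, div_eq_mul_inv]
    rw [fderiv_mul_const ((hψ.differentiable (by simp)) y)]
    simp [mul_comm]
  funext y
  simp only [lap, Finset.sum_div]
  refine Finset.sum_congr rfl fun i _ => ?_
  rw [h hφ, h (contDiff_partialDeriv hφ i)]

theorem lap_lap_radial_scaled {f : ℝ → ℝ} (hf : IsProfile f) (x : E d) {ε : ℝ} (hε : 0 < ε) :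
    lap (lap (fun y => f (‖y - x‖ ^ 2 / ε ^ 2))) =
      fun y => radialLap d (radialLap d f) (‖y - x‖ ^ 2 / ε ^ 2) / ε ^ 4 := by
  rw [lap_radial_scaled hf x hε, lap_div_const ((hf.radialLap d).contDiff_radial x ε),
    lap_radial_scaled (hf.radialLap d) x hε]
  funext y
  field_simp

end Partial

/-! ### The gradient of a Stokes solution is weakly biharmonic -/

section Weak

variable {d : ℕ} {U : Set (E d)}

theorem IsTestFunction.integrableOn_mul {φ k : E d → ℝ} (hφ : IsTestFunction U φ)
    (hk : LocallyIntegrableOn k U volume) : IntegrableOn (fun x => k x * φ x) U volume := by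
  have h1 : IntegrableOn k (tsupport φ) volume :=
    hk.integrableOn_compact_subset hφ.support_subset hφ.compact
  have h2 : IntegrableOn (fun x => k x * φ x) (tsupport φ) volume :=
    h1.mul_continuousOn hφ.smooth.continuous.continuousOn hφ.compact
  refine ((integrableOn_iff_integrable_of_support_subset ?_).1 h2).integrableOn
  exact (Function.support_mul_subset_right k φ).trans (subset_tsupport φ)

namespace IsStokesSolution

variable {v : E d → E d} {p : E d → ℝ}

theorem hasWeakPartialDeriv (hU : IsOpen U) (h : IsStokesSolution U v p) (i j : Fin d) :
    HasWeakPartialDeriv U j (fun y => v y i) (weakPartial U j fun y => v y i) :=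
  (MemH1.weakPartial_spec hU (h.memH1 i) j).1

theorem memLp_weakPartial (hU : IsOpen U) (h : IsStokesSolution U v p) (i j : Fin d) :
    MemLp (weakPartial U j fun y => v y i) 2 (volume.restrict U) :=
  (MemH1.weakPartial_spec hU (h.memH1 i) j).2

theorem integrableOn_weakPartial_mul (hU : IsOpen U) (h : IsStokesSolution U v p) (i j : Fin d)
    {φ : E d → ℝ} (hφ : IsTestFunction U φ) :
    IntegrableOn (fun x => weakPartial U j (fun y => v y i) x * φ x) U volume :=
  hφ.integrableOn_mul (h.hasWeakPartialDeriv hU i j).locallyIntegrable_deriv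

/-- Both sides equal `-∫ v_i ∂_j ∂_k η`. This replaces the symmetry of second derivatives of `v`,
which need not exist a priori. -/
theorem integral_weakPartial_swap (hU : IsOpen U) (h : IsStokesSolution U v p) (i j k : Fin d)
    {η : E d → ℝ} (hη : IsTestFunction U η) :
    ∫ x in U, weakPartial U j (fun y => v y i) x * partialDeriv k η x =
      ∫ x in U, weakPartial U k (fun y => v y i) x * partialDeriv j η x := by
  have h1 := (h.hasWeakPartialDeriv hU i j).integral_eq _ (hη.partialDeriv k)
  have h2 := (h.hasWeakPartialDeriv hU i k).integral_eq _ (hη.partialDeriv j)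
  rw [partialDeriv_comm hη.smooth] at h1
  exact neg_injective (h1.symm.trans h2)

theorem sum_integral_eq (hU : IsOpen U) (h : IsStokesSolution U v p) (i : Fin d)
    {φ : E d → ℝ} (hφ : IsTestFunction U φ) :
    ∑ j, ∫ x in U, weakPartial U j (fun y => v y i) x * partialDeriv j φ x =
      ∫ x in U, p x * partialDeriv i φ x := by
  rw [← integral_finsetSum _ fun j _ => h.integrableOn_weakPartial_mul hU i j (hφ.partialDeriv j)]
  exact sub_eq_zero.1 (h.momentum i φ hφ)

/-- The divergence of the momentum equation: its `i`-th component is tested with `∂_i ψ` and summed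
over `i`. Swapping indices collects the velocity terms into the divergence, which vanishes. -/
theorem integral_pressure_mul_lap (hU : IsOpen U) (h : IsStokesSolution U v p)
    {ψ : E d → ℝ} (hψ : IsTestFunction U ψ) : ∫ x in U, p x * lap ψ x = 0 := by
  have hp : LocallyIntegrableOn p U volume := 
    locallyIntegrableOn_of_locallyIntegrable_restrict (h.memL2.locallyIntegrable (by norm_num))
  have hdd : ∀ i, IsTestFunction U (partialDeriv i (partialDeriv i ψ)) := fun i =>
    (hψ.partialDeriv i).partialDeriv i
  calc ∫ x in U, p x * lap ψ x
      = ∑ i, ∫ x in U, p x * partialDeriv i (partialDeriv i ψ) x := by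
        rw [← integral_finsetSum _ fun i _ => (hdd i).integrableOn_mul hp]
        simp only [lap, Finset.mul_sum]
    _ = ∑ i, ∑ j, ∫ x in U, weakPartial U i (fun y => v y i) x *
          partialDeriv j (partialDeriv j ψ) x := by
        refine Finset.sum_congr rfl fun i _ => ?_
        rw [← h.sum_integral_eq hU i (hψ.partialDeriv i)]
        refine Finset.sum_congr rfl fun j _ => ?_
        rw [partialDeriv_comm hψ.smooth, h.integral_weakPartial_swap hU i j i (hψ.partialDeriv j)]
    _ = ∫ x in U, (∑ i, weakPartial U i (fun y => v y i) x) * lap ψ x := by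
        simp only [lap, Finset.sum_mul, Finset.mul_sum]
        rw [Finset.sum_comm, integral_finsetSum]
        · refine Finset.sum_congr rfl fun j _ => ?_
          rw [integral_finsetSum _ fun i _ => h.integrableOn_weakPartial_mul hU i i (hdd j)]
        · exact fun j _ => integrable_finsetSum _ fun i _ =>
            h.integrableOn_weakPartial_mul hU i i (hdd j)
    _ = 0 := by
        refine integral_eq_zero_of_ae ?_
        filter_upwards [h.divergence] with x hx
        simp [hx]

/-- Testing the momentum equation with `∂_j Δφ` moves the fourth-order expression onto the pressure,
which is weakly harmonic. -/
theorem integral_weakPartial_mul_lap_lap (hU : IsOpen U) (h : IsStokesSolution U v p)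
    (i j : Fin d) {φ : E d → ℝ} (hφ : IsTestFunction U φ) :
    ∫ x in U, weakPartial U j (fun y => v y i) x * lap (lap φ) x = 0 := by
  have hη := hφ.lap
  calc ∫ x in U, weakPartial U j (fun y => v y i) x * lap (lap φ) x
      = ∑ k, ∫ x in U, weakPartial U j (fun y => v y i) x *
          partialDeriv k (partialDeriv k (lap φ)) x := by
        rw [← integral_finsetSum _ fun k _ =>
          h.integrableOn_weakPartial_mul hU i j ((hη.partialDeriv k).partialDeriv k)]
        simp only [lap.eq_def (lap φ), Finset.mul_sum]
    _ = ∑ k, ∫ x in U, weakPartial U k (fun y => v y i) x *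
          partialDeriv k (partialDeriv j (lap φ)) x := by
        refine Finset.sum_congr rfl fun k _ => ?_
        rw [h.integral_weakPartial_swap hU i j k (hη.partialDeriv k),
          partialDeriv_comm hη.smooth]
    _ = ∫ x in U, p x * lap (partialDeriv i (partialDeriv j φ)) x := by
        rw [h.sum_integral_eq hU i (hη.partialDeriv j), partialDeriv_lap hφ.smooth,
          partialDeriv_lap (hφ.partialDeriv j).smooth]
    _ = 0 := h.integral_pressure_mul_lap hU ((hφ.partialDeriv j).partialDeriv i)

end IsStokesSolution

end Weak

/-! ### Mass of the mean value kernel -/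

section Mass

variable {d : ℕ}

theorem IsProfile.hasCompactSupport_radial {f : ℝ → ℝ} (hf : IsProfile f) (x : E d) {ε : ℝ}
    (hε : 0 < ε) : HasCompactSupport (fun y => f (‖y - x‖ ^ 2 / ε ^ 2)) :=
  (hf.isTestFunction hε (subset_univ _)).compact

theorem IsProfile.contDiff_norm_sq {f : ℝ → ℝ} (hf : IsProfile f) :
    ContDiff ℝ ∞ (fun y : E d => f (‖y‖ ^ 2)) := by
  simpa using hf.contDiff_radial (0 : E d) 1

theorem IsProfile.hasCompactSupport_norm_sq {f : ℝ → ℝ} (hf : IsProfile f) :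
    HasCompactSupport (fun y : E d => f (‖y‖ ^ 2)) := by
  simpa using hf.hasCompactSupport_radial (0 : E d) one_pos

theorem IsProfile.integrable_norm_sq {f : ℝ → ℝ} (hf : IsProfile f) :
    Integrable (fun y : E d => f (‖y‖ ^ 2)) :=
  hf.contDiff_norm_sq.continuous.integrable_of_hasCompactSupport hf.hasCompactSupport_norm_sq

theorem integral_coord_mul_partialDeriv {φ : E d → ℝ} (hφ : IsTestFunction univ φ) (i : Fin d) :
    Integrable (fun y : E d => y i * partialDeriv i φ y) ∧
      ∫ y : E d, y i * partialDeriv i φ y = - ∫ y, φ y := by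
  have hfd : ∀ y : E d, HasFDerivAt (fun y : E d => y i) (EuclideanSpace.proj i : E d →L[ℝ] ℝ) y :=
    fun y => (EuclideanSpace.proj i : E d →L[ℝ] ℝ).hasFDerivAt
  have h1 : ∀ y : E d, fderiv ℝ (fun y : E d => y i) y (EuclideanSpace.single i 1) = 1 := by
    intro y
    rw [(hfd y).fderiv]
    simp
  have hc : Continuous fun y : E d => y i := (EuclideanSpace.proj i : E d →L[ℝ] ℝ).continuous
  have hi : Integrable (fun y : E d => y i * partialDeriv i φ y) :=
    (hc.mul (hφ.partialDeriv i).smooth.continuous).integrable_of_hasCompactSupport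
      (hφ.partialDeriv i).compact.mul_left
  refine ⟨hi, ?_⟩
  have := integral_mul_fderiv_eq_neg_fderiv_mul_of_integrable (μ := volume)
    (f := fun y : E d => y i) (g := φ) (v := EuclideanSpace.single i 1) ?_ hi ?_
    (fun y _ => (hfd y).differentiableAt) (fun y _ => hφ.smooth.differentiable (by simp) y)
  · simp only [h1, one_mul] at this
    exact this
  · simpa only [h1, one_mul] using
      hφ.smooth.continuous.integrable_of_hasCompactSupport hφ.compact
  · exact (hc.mul hφ.smooth.continuous).integrable_of_hasCompactSupport hφ.compact.mul_left

/-- The field `u (‖y‖ ^ 2) y` has compact support, so its divergence `d u + 2 ‖y‖ ^ 2 u'` integrates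
to zero. -/
theorem integral_normSq_mul_deriv {u : ℝ → ℝ} (hu : IsProfile u) :
    2 * ∫ y : E d, ‖y‖ ^ 2 * deriv u (‖y‖ ^ 2) = - (d * ∫ y : E d, u (‖y‖ ^ 2)) := by
  have hφ : IsTestFunction univ (fun y : E d => u (‖y‖ ^ 2)) :=
    ⟨hu.contDiff_norm_sq, hu.hasCompactSupport_norm_sq, subset_univ _⟩
  have hp : ∀ i, partialDeriv i (fun y : E d => u (‖y‖ ^ 2)) =
      fun y => 2 * y i * deriv u (‖y‖ ^ 2) := fun i => by
    simpa using partialDeriv_radial hu.differentiable (0 : E d) i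
  have h : ∑ i : Fin d, ∫ y : E d, y i * partialDeriv i (fun y : E d => u (‖y‖ ^ 2)) y =
      2 * ∫ y : E d, ‖y‖ ^ 2 * deriv u (‖y‖ ^ 2) := by
    rw [← integral_finsetSum _ fun i _ => (integral_coord_mul_partialDeriv hφ i).1,
      ← integral_const_mul]
    congr 1 with y
    simp only [hp]
    rw [EuclideanSpace.real_norm_sq_eq, Finset.sum_mul, Finset.mul_sum]
    exact Finset.sum_congr rfl fun i _ => by ring
  rw [← h, Finset.sum_congr rfl fun i _ => (integral_coord_mul_partialDeriv hφ i).2]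
  simp

/-- The mean value kernel attached to a profile. -/
noncomputable def meanKernel (d : ℕ) (f : ℝ → ℝ) (t : ℝ) : ℝ :=
  2 * deriv (radialLap d f) t

theorem IsProfile.meanKernel {f : ℝ → ℝ} (hf : IsProfile f) (d : ℕ) :
    IsProfile (meanKernel d f) :=
  (hf.radialLap d).deriv.mul_left contDiff_const

theorem meanKernel_apply {f : ℝ → ℝ} (hf : IsProfile f) (t : ℝ) :
    meanKernel d f t =
      8 * (t * deriv (deriv (deriv f)) t) + (8 + 4 * d) * deriv (deriv f) t := by
  have h1 := (hf.deriv.deriv.differentiable t).hasDerivAt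
  have h2 := (hf.deriv.differentiable t).hasDerivAt
  have h3 : HasDerivAt (radialLap d f) _ t :=
    (((hasDerivAt_id t).const_mul 4).fun_mul h1).add (h2.const_mul (2 * d : ℝ))
  rw [meanKernel, h3.deriv]
  simp
  ring

/-- Integrating the third-derivative term by parts cancels exactly the `4 * d` in
`meanKernel_apply`, so the sign of the mass is governed by `f''` alone. -/
theorem integral_meanKernel {f : ℝ → ℝ} (hf : IsProfile f) :
    ∫ y : E d, meanKernel d f (‖y‖ ^ 2) =
      8 * ∫ y : E d, deriv (deriv f) (‖y‖ ^ 2) := by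
  have hu := hf.deriv.deriv
  simp only [meanKernel_apply hf]
  rw [integral_add, integral_const_mul, integral_const_mul]
  · linear_combination 4 * integral_normSq_mul_deriv (d := d) hu
  · exact ((hu.deriv.mul_left contDiff_id).integrable_norm_sq).const_mul _
  · exact hu.integrable_norm_sq.const_mul _

/-- There is a profile whose mean value kernel has positive mass. -/
theorem exists_profile_integral_meanKernel_pos (d : ℕ) :
    ∃ f, IsProfile f ∧ 0 < ∫ y : E d, meanKernel d f (‖y‖ ^ 2) := by
  -- This nonnegative, nonzero function is to be `f''`.
  have hu : IsProfile fun t => expNegInvGlue (1 - t) :=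
    ⟨expNegInvGlue.contDiff.comp (contDiff_const.sub contDiff_id),
      fun t ht => expNegInvGlue.zero_of_nonpos (by linarith)⟩
  obtain ⟨g, hg, hgu⟩ := hu.exists_antideriv
  obtain ⟨f, hf, hfg⟩ := hg.exists_antideriv
  refine ⟨f, hf, ?_⟩
  rw [integral_meanKernel hf, hfg, hgu]
  refine mul_pos (by norm_num) ?_
  refine Continuous.integral_pos_of_hasCompactSupport_nonneg_nonzero (x := 0)
    hu.contDiff_norm_sq.continuous hu.hasCompactSupport_norm_sq
    (fun y => expNegInvGlue.nonneg _) ?_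
  exact (expNegInvGlue.pos_of_pos (by simp)).ne'

theorem integral_scaled (k : ℝ → ℝ) (x : E d) {ε : ℝ} (hε : 0 < ε) :
    ∫ y : E d, k (‖y - x‖ ^ 2 / ε ^ 2) = ε ^ d * ∫ y : E d, k (‖y‖ ^ 2) := by
  rw [integral_sub_right_eq_self (fun y : E d => k (‖y‖ ^ 2 / ε ^ 2)) x]
  have h := Measure.integral_comp_inv_smul volume (fun y : E d => k (‖y‖ ^ 2)) ε
  simp only [norm_smul, mul_pow, norm_inv, Real.norm_eq_abs, inv_pow, sq_abs,
    finrank_euclideanSpace, Fintype.card_fin, smul_eq_mul, abs_of_pos (pow_pos hε d)] at h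
  rw [← h]
  simp only [div_eq_inv_mul]

end Mass

/-! ### Weakly biharmonic functions -/

section Biharmonic

variable {d : ℕ}

/-- Averages of `w` over `U` against the rescaled mean value kernel around `x`. -/
noncomputable def kernelMean (d : ℕ) (f : ℝ → ℝ) (U : Set (E d)) (w : E d → ℝ) (x : E d) (ε : ℝ) :
    ℝ :=
  (ε ^ d)⁻¹ * ∫ y in U, w y * meanKernel d f (‖y - x‖ ^ 2 / ε ^ 2)

theorem IsProfile.integrable_mul_radial {k : ℝ → ℝ} (hk : IsProfile k) {U : Set (E d)}
    {w : E d → ℝ} (hw : IntegrableOn w U) (x : E d) (ε : ℝ) :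
    IntegrableOn (fun y => w y * k (‖y - x‖ ^ 2 / ε ^ 2)) U := by
  obtain ⟨M, -, hM⟩ := hk.exists_bound
  exact Integrable.mul_bdd (c := M) hw (hk.contDiff_radial x ε).continuous.aestronglyMeasurable
    (Eventually.of_forall fun y => hM _ (by positivity))

theorem hasDerivAt_integral_radial {k : ℝ → ℝ} (hk : IsProfile k) {U : Set (E d)}
    {w : E d → ℝ} (hw : IntegrableOn w U) (x : E d) {ε : ℝ} (hε : 0 < ε) :
    HasDerivAt (fun ε => ∫ y in U, w y * k (‖y - x‖ ^ 2 / ε ^ 2))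
      (-(2 / ε) * ∫ y in U, w y * ((‖y - x‖ ^ 2 / ε ^ 2) * deriv k (‖y - x‖ ^ 2 / ε ^ 2))) ε := by
  have hq : IsProfile fun t => t * deriv k t := hk.deriv.mul_left contDiff_id
  obtain ⟨M, hM0, hM⟩ := hq.exists_bound
  rw [← integral_const_mul]
  -- Keeping the scale above `ε / 2` bounds the prefactor `2 / δ` by `4 / ε`, which gives an
  -- integrable majorant.
  refine (hasDerivAt_integral_of_dominated_loc_of_deriv_le (s := Ioi (ε / 2))
    (F := fun ε y => w y * k (‖y - x‖ ^ 2 / ε ^ 2))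
    (bound := fun y => 4 / ε * M * |w y|)
    (F' := fun ε y => -(2 / ε) *
      (w y * ((‖y - x‖ ^ 2 / ε ^ 2) * deriv k (‖y - x‖ ^ 2 / ε ^ 2))))
    (Ioi_mem_nhds (by linarith)) ?_ (hk.integrable_mul_radial hw x ε) ?_ ?_ ?_ ?_).2
  · exact Eventually.of_forall fun δ => (hk.integrable_mul_radial hw x δ).aestronglyMeasurable
  · exact ((hq.integrable_mul_radial hw x ε).const_mul _).aestronglyMeasurable
  · refine Eventually.of_forall fun y δ hδ => ?_
    have hδ' : ε / 2 < δ := hδ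
    have hδ0 : 0 < δ := by linarith
    rw [norm_mul, norm_mul, norm_neg, Real.norm_eq_abs, Real.norm_eq_abs, Real.norm_eq_abs,
      abs_of_pos (by positivity : 0 < 2 / δ)]
    have h1 : 2 / δ ≤ 4 / ε := by
      rw [div_le_div_iff₀ hδ0 hε]
      linarith
    calc 2 / δ * (|w y| * |‖y - x‖ ^ 2 / δ ^ 2 * deriv k (‖y - x‖ ^ 2 / δ ^ 2)|)
        ≤ 4 / ε * (|w y| * M) := by
          gcongr
          exact hM _ (by positivity)
      _ = 4 / ε * M * |w y| := by ring
  · exact hw.abs.const_mul _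
  · refine Eventually.of_forall fun y δ hδ => ?_
    have hδ' : ε / 2 < δ := hδ
    have hδ0 : 0 < δ := by linarith
    have h1 : HasDerivAt (fun δ : ℝ => ‖y - x‖ ^ 2 / δ ^ 2)
        (-(2 / δ) * (‖y - x‖ ^ 2 / δ ^ 2)) δ := by
      have := (hasDerivAt_const δ (‖y - x‖ ^ 2)).div (hasDerivAt_pow 2 δ) (by positivity)
      refine this.congr_deriv ?_
      field_simp
      ring
    have h2 := ((hk.differentiable (‖y - x‖ ^ 2 / δ ^ 2)).hasDerivAt.comp δ h1).const_mul (w y)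
    refine h2.congr_deriv ?_
    ring

/-- With `g = radialLap d f` and `k = 2 g'`, differentiating `ε ^ (-d) k (‖y - x‖ ^ 2 / ε ^ 2)` in
`ε` produces `-(d k + 2 t k') / ε ^ (d + 1)`. Since `d k + 2 t k' = 4 t g'' + 2 d g' = radialLap d
g`, this is a multiple of the double Laplacian of a test function. The factor `2 g'` in `meanKernel`
is chosen for this identity. -/
theorem hasDerivAt_kernelMean {f : ℝ → ℝ} (hf : IsProfile f) {U : Set (E d)} {w : E d → ℝ}
    (hw : IntegrableOn w U)
    (hΔ : ∀ φ, IsTestFunction U φ → ∫ y in U, w y * lap (lap φ) y = 0)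
    {x : E d} {ε : ℝ} (hε : 0 < ε) (hU : closedBall x ε ⊆ U) :
    HasDerivAt (kernelMean d f U w x) 0 ε := by
  have hk := hf.meanKernel d
  have hq : IsProfile fun t => t * deriv (meanKernel d f) t := hk.deriv.mul_left contDiff_id
  have h0 : d * (∫ y in U, w y * meanKernel d f (‖y - x‖ ^ 2 / ε ^ 2)) +
      2 * ∫ y in U, w y * ((‖y - x‖ ^ 2 / ε ^ 2) *
        deriv (meanKernel d f) (‖y - x‖ ^ 2 / ε ^ 2)) = 0 := by
    rw [← integral_const_mul, ← integral_const_mul, ← integral_add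
      ((hk.integrable_mul_radial hw x ε).const_mul _)
      ((hq.integrable_mul_radial hw x ε).const_mul _)]
    have h := hΔ _ (hf.isTestFunction hε hU)
    rw [lap_lap_radial_scaled hf x hε] at h
    have hd : deriv (meanKernel d f) = fun t => 2 * deriv (deriv (radialLap d f)) t :=
      funext fun t => deriv_const_mul _ ((hf.radialLap d).deriv.differentiable t)
    have : ∀ y : E d, d * (w y * meanKernel d f (‖y - x‖ ^ 2 / ε ^ 2)) +
        2 * (w y * ((‖y - x‖ ^ 2 / ε ^ 2) * deriv (meanKernel d f) (‖y - x‖ ^ 2 / ε ^ 2))) =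
        ε ^ 4 * (w y * (radialLap d (radialLap d f) (‖y - x‖ ^ 2 / ε ^ 2) / ε ^ 4)) := by
      intro y
      rw [hd, meanKernel, radialLap.eq_def d (radialLap d f)]
      field_simp
      ring
    simp only [this]
    rw [integral_const_mul, h, mul_zero]
  have h1 : HasDerivAt (fun ε : ℝ => (ε ^ d)⁻¹) (-(d / ε) * (ε ^ d)⁻¹) ε := by
    refine ((hasDerivAt_pow d ε).fun_inv (by positivity)).congr_deriv ?_
    rcases d with _ | n
    · simp
    · simp only [Nat.add_sub_cancel]
      field_simp
      ring
  refine (h1.mul (hasDerivAt_integral_radial hk hw x hε)).congr_deriv ?_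
  linear_combination -((ε ^ d)⁻¹ / ε) * h0

theorem kernelMean_eq {f : ℝ → ℝ} (hf : IsProfile f) {U : Set (E d)} {w : E d → ℝ}
    (hw : IntegrableOn w U)
    (hΔ : ∀ φ, IsTestFunction U φ → ∫ y in U, w y * lap (lap φ) y = 0)
    {x : E d} {ρ : ℝ} (hU : ball x ρ ⊆ U) {ε δ : ℝ} (hε : ε ∈ Ioo 0 ρ) (hδ : δ ∈ Ioo 0 ρ) :
    kernelMean d f U w x ε = kernelMean d f U w x δ := by
  have h : ∀ s ∈ Ioo 0 ρ, HasDerivAt (kernelMean d f U w x) 0 s := fun s hs =>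
    hasDerivAt_kernelMean hf hw hΔ hs.1 ((closedBall_subset_ball hs.2).trans hU)
  exact isOpen_Ioo.is_const_of_deriv_eq_zero isPreconnected_Ioo
    (fun s hs => (h s hs).differentiableAt.differentiableWithinAt)
    (fun s hs => (h s hs).deriv) hε hδ

/-- Lebesgue differentiation. The kernel need not be nonnegative: at a Lebesgue point it suffices
that, divided by its mass, it integrates to one, lives in the ball of radius `ε` and is bounded by a
constant over the volume of that ball. -/
theorem ae_tendsto_kernelMean {f : ℝ → ℝ} (hf : IsProfile f)
    (hc : 0 < ∫ y : E d, meanKernel d f (‖y‖ ^ 2)) {U : Set (E d)} (hU : MeasurableSet U)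
    {w : E d → ℝ} (hw : IntegrableOn w U) :
    ∀ᵐ x, x ∈ U → Tendsto (kernelMean d f U w x) (𝓝[>] 0)
      (𝓝 ((∫ y : E d, meanKernel d f (‖y‖ ^ 2)) * w x)) := by
  set c := ∫ y : E d, meanKernel d f (‖y‖ ^ 2) with hc_def
  have hk := hf.meanKernel d
  obtain ⟨M, hM0, hM⟩ := hk.exists_bound
  have hi : Integrable (U.indicator w) := (integrable_indicator_iff hU).2 hw
  filter_upwards [(Besicovitch.vitaliFamily volume).ae_tendsto_average_norm_sub
    hi.locallyIntegrable] with x hx hxU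
  have h1 := hx.comp (Besicovitch.tendsto_filterAt volume x)
  have hpos : ∀ᶠ ε : ℝ in 𝓝[>] 0, 0 < ε := self_mem_nhdsWithin
  have h2 := tendsto_integral_smul_of_tendsto_average_norm_sub
    (g := fun ε y => c⁻¹ * (ε ^ d)⁻¹ * meanKernel d f (‖y - x‖ ^ 2 / ε ^ 2))
    (c⁻¹ * M * volume.real (ball (0 : E d) 1)) h1
    (Eventually.of_forall fun ε => hi.integrableOn) ?_ ?_ ?_
  · have h3 := h2.const_mul c
    rw [indicator_of_mem hxU] at h3
    refine h3.congr' (hpos.mono fun ε hε => ?_)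
    rw [kernelMean, ← integral_indicator hU, ← integral_const_mul, ← integral_const_mul]
    congr 1 with y
    by_cases hy : y ∈ U
    · simp only [indicator_of_mem hy, smul_eq_mul]
      field_simp
    · simp [indicator_of_notMem hy]
  · refine tendsto_const_nhds.congr' (hpos.mono fun ε hε => ?_)
    simp only [integral_const_mul, integral_scaled _ x hε]
    field_simp
    exact hc_def
  · refine hpos.mono fun ε hε y hy => ?_
    by_contra h
    exact hy (by simp [hk.apply_eq_zero hε fun h' => h (ball_subset_closedBall h')])
  · refine hpos.mono fun ε hε y => ?_
    rw [Measure.addHaar_real_closedBall _ _ hε.le, finrank_euclideanSpace, Fintype.card_fin,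
      abs_mul, abs_of_pos (by positivity : 0 < c⁻¹ * (ε ^ d)⁻¹)]
    have hB : 0 < volume.real (ball (0 : E d) 1) :=
      ENNReal.toReal_pos (measure_ball_pos _ _ one_pos).ne' measure_ball_lt_top.ne
    calc c⁻¹ * (ε ^ d)⁻¹ * |meanKernel d f (‖y - x‖ ^ 2 / ε ^ 2)| ≤ c⁻¹ * (ε ^ d)⁻¹ * M := by
          gcongr
          exact hM _ (by positivity)
      _ = _ := by field_simp

theorem real_ball_eq (x : E d) {r : ℝ} (hr : 0 < r) :
    volume.real (ball x r) = r ^ d * volume.real (ball (0 : E d) 1) := by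
  rw [measureReal_def, Measure.addHaar_ball_of_pos _ _ hr, finrank_euclideanSpace, Fintype.card_fin,
    ENNReal.toReal_mul, ENNReal.toReal_ofReal (by positivity), measureReal_def]

/-- The Cauchy–Schwarz inequality against the constant `1`. -/
theorem sq_integral_abs_le {α : Type*} [MeasurableSpace α] {μ : Measure α} [IsFiniteMeasure μ]
    {w : α → ℝ} (hw : MemLp w 2 μ) : (∫ y, |w y| ∂μ) ^ 2 ≤ μ.real univ * ∫ y, w y ^ 2 ∂μ := by
  have h2 : Integrable (fun y => w y ^ 2) μ := hw.integrable_sq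
  have h1 : Integrable (fun y => |w y|) μ := (hw.integrable (by norm_num)).abs
  set S := ∫ y, |w y| ∂μ with hS
  set V := μ.real univ with hV
  have key : ∀ a : ℝ, 0 ≤ (∫ y, w y ^ 2 ∂μ) - 2 * a * S + a ^ 2 * V := by
    intro a
    have h : ∫ y, (|w y| - a) ^ 2 ∂μ = (∫ y, w y ^ 2 ∂μ) - 2 * a * S + a ^ 2 * V := by
      have e : ∀ y, (|w y| - a) ^ 2 = w y ^ 2 - 2 * a * |w y| + a ^ 2 := fun y => by
        rw [sub_sq, sq_abs]
        ring
      simp only [e]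
      have h3 : Integrable (fun y => w y ^ 2 - 2 * a * |w y|) μ := h2.sub (h1.const_mul _)
      rw [integral_add h3 (integrable_const _), integral_sub h2 (h1.const_mul _), integral_const_mul, integral_const]
      simp [hS, hV, mul_comm]
    rw [← h]
    exact integral_nonneg fun y => sq_nonneg _
  rcases (measureReal_nonneg : 0 ≤ V).eq_or_lt with h0 | h0
  · have hμ : μ = 0 := by
      rw [eq_comm, measureReal_eq_zero_iff] at h0
      exact Measure.measure_univ_eq_zero.1 h0
    simp [hS, hμ]
  -- The value `S / V` minimises the quadratic in `a`.
  · have := key (S / V)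
    have e : (∫ y, w y ^ 2 ∂μ) - 2 * (S / V) * S + (S / V) ^ 2 * V =
        (∫ y, w y ^ 2 ∂μ) - S ^ 2 / V := by
      field_simp
      ring
    rw [e, sub_nonneg, div_le_iff₀ h0] at this
    linarith

/-- Interior sup bound for weakly biharmonic functions. -/
theorem exists_sq_le_of_biharmonic (d : ℕ) : ∃ C : ℝ, 0 < C ∧ ∀ R : ℝ, 0 < R → ∀ w : E d → ℝ,
    MemLp w 2 (volume.restrict (ball 0 R)) →
    (∀ φ, IsTestFunction (ball 0 R) φ → ∫ y in ball 0 R, w y * lap (lap φ) y = 0) →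
    ∀ᵐ x, x ∈ ball (0 : E d) (R / 2) → w x ^ 2 ≤ C * (R ^ d)⁻¹ * ∫ y in ball 0 R, w y ^ 2 := by
  obtain ⟨f, hf, hc⟩ := exists_profile_integral_meanKernel_pos d
  obtain ⟨M, hM0, hM⟩ := (hf.meanKernel d).exists_bound
  set c := ∫ y : E d, meanKernel d f (‖y‖ ^ 2)
  set V := volume.real (ball (0 : E d) 1)
  have hV : 0 < V := ENNReal.toReal_pos (measure_ball_pos _ _ one_pos).ne' measure_ball_lt_top.ne
  -- The factor `16 ^ d` is the square of the `4 ^ d` coming from the scale `R / 4`; `M` bounds the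
  -- kernel and `V` comes from Cauchy–Schwarz.
  refine ⟨16 ^ d * M ^ 2 * V / c ^ 2, by positivity, fun R hR w hw hΔ => ?_⟩
  have : IsFiniteMeasure (volume.restrict (ball (0 : E d) R)) :=
    isFiniteMeasure_restrict.2 measure_ball_lt_top.ne
  have hwi : IntegrableOn w (ball 0 R) := hw.integrable (by norm_num)
  filter_upwards [ae_tendsto_kernelMean hf hc measurableSet_ball hwi] with x hx hxR
  have hsub : ball x (R / 2) ⊆ ball 0 R := ball_subset_ball' (by
    rw [mem_ball] at hxR
    linarith)
  have hlim := hx (ball_subset_ball (by linarith) hxR)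
  -- Any scale strictly between `0` and `R / 2` would serve, since the ball of radius `R / 2` around
  -- `x` stays in the domain.
  have hconst : c * w x = kernelMean d f (ball 0 R) w x (R / 4) := by
    refine tendsto_nhds_unique hlim (tendsto_const_nhds.congr' ?_)
    filter_upwards [Ioo_mem_nhdsGT (by positivity : (0 : ℝ) < R / 2)] with ε hε
    exact kernelMean_eq hf hwi hΔ hsub ⟨by positivity, by linarith⟩ hε
  have hI : |∫ y in ball 0 R, w y * meanKernel d f (‖y - x‖ ^ 2 / (R / 4) ^ 2)| ≤
      M * ∫ y in ball 0 R, |w y| := by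
    rw [← integral_const_mul, ← Real.norm_eq_abs]
    refine norm_integral_le_of_norm_le (hwi.abs.const_mul M) (Eventually.of_forall fun y => ?_)
    rw [norm_mul, mul_comm]
    gcongr
    · exact hM _ (by positivity)
    · exact le_rfl
  have hS := sq_integral_abs_le hw
  rw [measureReal_restrict_apply_univ, real_ball_eq _ hR] at hS
  have hsq : (c * w x) ^ 2 ≤
      (((R / 4) ^ d)⁻¹) ^ 2 * (M ^ 2 * (R ^ d * V * ∫ y in ball 0 R, w y ^ 2)) := by
    rw [hconst, kernelMean, mul_pow]
    gcongr
    calc _ ≤ (M * ∫ y in ball 0 R, |w y|) ^ 2 := sq_le_sq' (abs_le.1 hI).1 (abs_le.1 hI).2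
      _ ≤ _ := by rw [mul_pow]; gcongr
  have h16 : (16 : ℝ) ^ d = (4 ^ d) ^ 2 := by rw [← pow_mul, mul_comm, pow_mul]; norm_num
  have e : (((R / 4) ^ d)⁻¹) ^ 2 * (M ^ 2 * (R ^ d * V * ∫ y in ball 0 R, w y ^ 2)) =
      c ^ 2 * (16 ^ d * M ^ 2 * V / c ^ 2 * (R ^ d)⁻¹ * ∫ y in ball 0 R, w y ^ 2) := by
    rw [div_pow, h16]
    field_simp
  rw [e, mul_pow] at hsq
  exact le_of_mul_le_mul_left hsq (by positivity)

end Biharmonic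

/-! ### Decay of the gradient -/

theorem integrableOn_gradSq {d : ℕ} {U : Set (E d)} (hU : IsOpen U) {v : E d → E d}
    {p : E d → ℝ} (h : IsStokesSolution U v p) : IntegrableOn (gradSq U v) U :=
  integrable_finsetSum _ fun i _ => integrable_finsetSum _ fun j _ =>
    (h.memLp_weakPartial hU i j).integrable_sq

end StokesDecay

theorem lemma3p2 (d : ℕ) (hd : 1 ≤ d) :
    ∃ C : ℝ, 0 < C ∧
      ∀ (R : ℝ), 0 < R →
      ∀ (v : StokesDecay.E d → StokesDecay.E d) (p : StokesDecay.E d → ℝ),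
        StokesDecay.IsStokesSolution (Metric.ball 0 R) v p →
        ∀ (r : ℝ), 0 < r → r ≤ R →
          ∫ x in Metric.ball 0 r, StokesDecay.gradSq (Metric.ball 0 R) v x
            ≤ C * (r / R) ^ d *
              ∫ x in Metric.ball 0 R, StokesDecay.gradSq (Metric.ball 0 R) v x := by
  obtain ⟨C, hC, hbound⟩ := StokesDecay.exists_sq_le_of_biharmonic d
  set V := volume.real (Metric.ball (0 : StokesDecay.E d) 1)
  have hV : 0 ≤ V := measureReal_nonneg
  -- The term `C * V` handles `r ≤ R / 2`, and `2 ^ d` handles `r > R / 2`, where `2 * r / R ≥ 1`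
  -- and monotonicity of the integral suffices.
  refine ⟨C * V + 2 ^ d, by positivity, fun R hR v p h r hr hrR => ?_⟩
  have hU : IsOpen (Metric.ball (0 : StokesDecay.E d) R) := Metric.isOpen_ball
  have hint := StokesDecay.integrableOn_gradSq hU h
  have h0 : ∀ x, 0 ≤ StokesDecay.gradSq (Metric.ball 0 R) v x := fun x =>
    Finset.sum_nonneg fun i _ => Finset.sum_nonneg fun j _ => sq_nonneg _
  set I := ∫ x in Metric.ball 0 R, StokesDecay.gradSq (Metric.ball 0 R) v x with hI
  have hI0 : 0 ≤ I := integral_nonneg h0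
  have hIsum : I = ∑ i, ∑ j, ∫ x in Metric.ball 0 R,
      StokesDecay.weakPartial (Metric.ball 0 R) j (fun y => v y i) x ^ 2 := by
    simp only [hI, StokesDecay.gradSq]
    rw [integral_finsetSum _ fun i _ => integrable_finsetSum _ fun j _ =>
      (h.memLp_weakPartial hU i j).integrable_sq]
    exact Finset.sum_congr rfl fun i _ => integral_finsetSum _ fun j _ =>
      (h.memLp_weakPartial hU i j).integrable_sq
  rcases le_or_gt r (R / 2) with hr2 | hr2
  · have hae : ∀ᵐ x, x ∈ Metric.ball (0 : StokesDecay.E d) r →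
        StokesDecay.gradSq (Metric.ball 0 R) v x ≤ C * (R ^ d)⁻¹ * I := by
      have : ∀ᵐ x, ∀ i j, x ∈ Metric.ball (0 : StokesDecay.E d) (R / 2) →
          StokesDecay.weakPartial (Metric.ball 0 R) j (fun y => v y i) x ^ 2 ≤
            C * (R ^ d)⁻¹ * ∫ x in Metric.ball 0 R,
              StokesDecay.weakPartial (Metric.ball 0 R) j (fun y => v y i) x ^ 2 :=
        ae_all_iff.2 fun i => ae_all_iff.2 fun j => hbound R hR _ (h.memLp_weakPartial hU i j)
          fun φ hφ => h.integral_weakPartial_mul_lap_lap hU i j hφ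
      filter_upwards [this] with x hx hxr
      rw [hIsum, Finset.mul_sum]
      refine Finset.sum_le_sum fun i _ => ?_
      rw [Finset.mul_sum]
      exact Finset.sum_le_sum fun j _ => hx i j (Metric.ball_subset_ball hr2 hxr)
    calc ∫ x in Metric.ball 0 r, StokesDecay.gradSq (Metric.ball 0 R) v x
        ≤ ∫ x in Metric.ball (0 : StokesDecay.E d) r, C * (R ^ d)⁻¹ * I :=
          setIntegral_mono_on_ae (hint.mono_set (Metric.ball_subset_ball hrR))
            (integrableOn_const measure_ball_lt_top.ne) measurableSet_ball hae
      _ = C * V * (r / R) ^ d * I := by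
          rw [setIntegral_const, StokesDecay.real_ball_eq _ hr, smul_eq_mul, div_pow]
          field_simp
          exact mul_comm _ _
      _ ≤ (C * V + 2 ^ d) * (r / R) ^ d * I := by
          gcongr
          linarith [pow_pos (two_pos : (0 : ℝ) < 2) d]
  · have h1 : 1 ≤ 2 ^ d * (r / R) ^ d := by
      rw [← mul_pow]
      refine one_le_pow₀ ?_
      rw [← mul_div_assoc, one_le_div hR]
      linarith
    calc ∫ x in Metric.ball 0 r, StokesDecay.gradSq (Metric.ball 0 R) v x ≤ I :=
          setIntegral_mono_set hint (Filter.Eventually.of_forall h0)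
            (Metric.ball_subset_ball hrR).eventuallyLE
      _ ≤ 2 ^ d * (r / R) ^ d * I := le_mul_of_one_le_left hI0 h1
      _ ≤ (C * V + 2 ^ d) * (r / R) ^ d * I := by
          gcongr
          linarith [mul_nonneg hC.le hV]
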